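/- Let $\Bbbk$ be a field and $n\ge 0$. The equi-oriented commutative ladder $CL(n)$ is the tensor product of the equi-oriented quivers $1\to 2\to\cdots\to n$ and $1\to 2$, that is, their Cartesian product with the relations that all squares commute. A representation of $CL(n)$ (or of any quiver) is a finite-dimensional $\Bbbk$-linear one. An interval of $CL(n)$ is a (nonempty) connected convex full subquiver $I$; intervals are ordered by inclusion of vertex sets, and the interval representation $V_I$ is $\Bbbk$ at the vertices of $I$, zero elsewhere, with identity maps along the arrows within $I$ and zero maps along the other arrows. The essential vertices of $I$ are the sources and the sinks of $I$. A course on $CL(n)$ is a pair $(C,F)$ of a finite connected quiver $C$ and a map $F$ from the vertices of $C$ to those of $CL(n)$ such that for each arrow $a\to b$ of $C$ there is a path from $F(a)$ to $F(b)$ in $CL(n)$. Its tour takes a representation $M$ of $CL(n)$ to the representation $\mathrm{Tour}_{(C,F)}(M)$ of $C$ with the space $M_{F(a)}$ at the vertex $a$ and with the evaluation of $M$ on a path from $F(a)$ to $F(b)$ along each arrow $a\to b$ (by commutativity the choice of the path does not matter). The course is essential in $I$ if all its labels lie in $I$ and each essential vertex of $I$ is a label. An essential assignment $\xi$ chooses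 for each interval $I$ a course $\xi(I)$ that is essential in $I$. The $\xi$-compressed multiplicity $c^{\xi}_M(I)$ is the multiplicity of $\mathrm{Tour}_{\xi(I)}(V_I)$ as a summand in the decomposition of $\mathrm{Tour}_{\xi(I)}(M)$ into indecomposables, and the interval approximation $\delta^{\xi}_M$ is the unique integer-valued function on the set of intervals with $$c^{\xi}_M(I)=\sum_{J\ge I}\delta^{\xi}_M(J)\qquad\text{for every interval } I .$$ **Proposition.** Let $M$ be a representation of $CL(n)$. If there exist an essential assignment $\xi$ and an interval $I$ of $CL(n)$ with $\delta^{\xi}_M(I)<0$, then $M$ has an indecomposable direct summand that is not isomorphic to $V_J$ for any interval $J$ of $CL(n)$. -/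

import Mathlib

open CategoryTheory CategoryTheory.Limits

/-! ### Quivers, intervals, courses -/

/-- A full subquiver, given by its set of vertices `S`, is connected if it is nonempty and its
underlying undirected graph is connected. -/
def QuiverConnectedOn {Q : Type*} [Quiver Q] (S : Set Q) : Prop :=
  S.Nonempty ∧ ∀ u v : S, Relation.EqvGen (fun a b : S => Nonempty (a.1 ⟶ b.1)) u v

/-- A full subquiver, given by its set of vertices `S`, is convex if every vertex on a path that
starts and ends in `S` belongs to `S`. -/
def QuiverConvex {Q : Type*} [Quiver Q] (S : Set Q) : Prop :=
  ∀ u ∈ S, ∀ v ∈ S, ∀ w : Q, Nonempty (Quiver.Path u w) → Nonempty (Quiver.Path w v) → w ∈ S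

/-- An interval of a fully commutative quiver (one that has no zero relations): a connected convex
full subquiver, given by its set of vertices. -/
@[ext]
structure QuiverInterval (Q : Type*) [Quiver Q] where
  carrier : Set Q
  connected : QuiverConnectedOn carrier
  convex : QuiverConvex carrier

namespace QuiverInterval

variable {Q : Type*} [Quiver Q]

/-- Intervals are ordered by inclusion of their vertex sets. -/
instance : PartialOrder (QuiverInterval Q) :=
  PartialOrder.lift QuiverInterval.carrier (fun _ _ h => QuiverInterval.ext h)

theorem le_def (I J : QuiverInterval Q) : I ≤ J ↔ I.carrier ⊆ J.carrier := Iff.rfl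

instance [Finite Q] : Finite (QuiverInterval Q) :=
  Finite.of_injective QuiverInterval.carrier (fun _ _ h => QuiverInterval.ext h)

/-- The essential vertices of `I`: the sources and the sinks of the full subquiver `I`. -/
def essentialVertices (I : QuiverInterval Q) : Set Q :=
  {v | v ∈ I.carrier ∧
    ((∀ u ∈ I.carrier, IsEmpty (u ⟶ v)) ∨ (∀ w ∈ I.carrier, IsEmpty (v ⟶ w)))}

end QuiverInterval

universe u v w q

set_option linter.checkUnivs false in
/-- A course on the quiver `Q`: a connected quiver `V` (with finitely many vertices) and a labeling
map `V → Q` such that each arrow of `V` goes between labels that are joined by a path of `Q`. -/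
structure Course (Q : Type q) [Quiver.{0} Q] where
  V : Type v
  [quiver : Quiver.{w} V]
  [finite : Finite V]
  connected : QuiverConnectedOn (Set.univ : Set V)
  label : V → Q
  exists_path : ∀ {a b : V}, (a ⟶ b) → Nonempty (Quiver.Path (label a) (label b))

attribute [instance] Course.quiver Course.finite

/-- The course `c` is essential in `I`. -/
def Course.IsEssentialIn {Q : Type q} [Quiver.{0} Q] (c : Course.{v, w, q} Q) (I : QuiverInterval Q) :
    Prop :=
  I.essentialVertices ⊆ Set.range c.label ∧ Set.range c.label ⊆ I.carrier

set_option linter.checkUnivs false in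
/-- An essential assignment: to each interval `I` an essential course in `I`. -/
structure EssentialAssignment (Q : Type q) [Quiver.{0} Q] where
  course : QuiverInterval Q → Course.{v, w, q} Q
  essential : ∀ I, (course I).IsEssentialIn I

/-! ### The equi-oriented commutative ladder -/

/-- The vertices of the equi-oriented quiver `• → • → ⋯ → •` of type `A_n`. -/
@[ext]
structure EquiA (n : ℕ) where
  idx : Fin n

/-- There is exactly one arrow from each vertex to the next one. -/
instance (n : ℕ) : Quiver (EquiA n) where
  Hom i j := PLift (i.idx.val + 1 = j.idx.val)

instance (n : ℕ) : Finite (EquiA n) :=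
  Finite.of_injective EquiA.idx (fun _ _ h => EquiA.ext h)

theorem EquiA.idx_le {n : ℕ} {i j : EquiA n} (p : Quiver.Path i j) : i.idx.val ≤ j.idx.val := by
  induction p with
  | nil => exact le_rfl
  | cons _ e ih => have := e.down; omega

theorem EquiA.path_eq {n : ℕ} {i j : EquiA n} (p p' : Quiver.Path i j) : p = p' := by
  induction p with
  | nil =>
    cases p' with
    | nil => rfl
    | cons q e => have := EquiA.idx_le q; have := e.down; omega
  | @cons j' l p e ih =>
    cases p' with
    | nil => have := EquiA.idx_le p; have := e.down; omega
    | @cons j'' _ q e' =>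
      have h : j' = j'' := by
        apply EquiA.ext; apply Fin.ext; have := e.down; have := e'.down; omega
      subst h
      rw [ih q]
      exact congrArg q.cons (Subsingleton.elim (α := PLift _) e e')

/-- The vertices of the Cartesian product of two quivers. -/
@[ext]
structure QuiverProd (A B : Type*) where
  fst : A
  snd : B

namespace QuiverProd

variable {A B : Type*} [Quiver A] [Quiver B]

/-- The arrows of the Cartesian product of two quivers. -/
inductive Arrow : QuiverProd A B → QuiverProd A B → Type _
  | left {a a' : A} (α : a ⟶ a') (b : B) : Arrow ⟨a, b⟩ ⟨a', b⟩
  | right (a : A) {b b' : B} (β : b ⟶ b') : Arrow ⟨a, b⟩ ⟨a, b'⟩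

instance : Quiver (QuiverProd A B) := ⟨Arrow⟩

instance [Finite A] [Finite B] : Finite (QuiverProd A B) :=
  Finite.of_injective (fun x => (x.fst, x.snd)) (fun x y h => by
    cases x; cases y; simpa using h)

def leftArrow {a a' : A} (α : a ⟶ a') (b : B) :
    (⟨a, b⟩ : QuiverProd A B) ⟶ ⟨a', b⟩ := Arrow.left α b

def rightArrow (a : A) {b b' : B} (β : b ⟶ b') :
    (⟨a, b⟩ : QuiverProd A B) ⟶ ⟨a, b'⟩ := Arrow.right a β

/-- The relations of the tensor product of two quivers: each square commutes. -/
inductive TensorRel : HomRel (Paths (QuiverProd A B))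
  | square {a a' : A} {b b' : B} (α : a ⟶ a') (β : b ⟶ b') :
      TensorRel (X := (⟨a, b⟩ : QuiverProd A B)) (Y := (⟨a', b'⟩ : QuiverProd A B))
        ((rightArrow a β).toPath.comp (leftArrow α b').toPath)
        ((leftArrow α b).toPath.comp (rightArrow a' β).toPath)

end QuiverProd

/-- The underlying quiver of the equi-oriented commutative ladder `CL(n)`. -/
abbrev Ladder (n : ℕ) := QuiverProd (EquiA n) (EquiA 2)

/-- The path category of `CL(n)` modulo the relations of `CL(n)`. -/
abbrev LadderCat (n : ℕ) := CategoryTheory.Quotient (@QuiverProd.TensorRel (EquiA n) (EquiA 2) _ _)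

/-- A vertex of `CL(n)` as an object of the category `LadderCat n`. -/
abbrev LadderCat.vertex {n : ℕ} (x : Ladder n) : LadderCat n := ⟨x⟩

/-- The class of a path of `CL(n)` modulo the relations. -/
abbrev LadderCat.pathClass {n : ℕ} {x y : Ladder n} (p : Quiver.Path x y) :
    LadderCat.vertex x ⟶ LadderCat.vertex y :=
  (CategoryTheory.Quotient.functor (@QuiverProd.TensorRel (EquiA n) (EquiA 2) _ _)).map
    (X := (x : Paths (Ladder n))) (Y := (y : Paths (Ladder n))) p

/-- The category of finite-dimensional representations of `CL(n)`. A representation of a quiver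
with relations is a functor on the path category which respects the relations, that is, a functor
on the quotient of the path category by the relations. -/
abbrev LadderRep (k : Type u) [Field k] (n : ℕ) := LadderCat n ⥤ FGModuleCat.{u} k

/-- The category of finite-dimensional representations of a quiver without relations. -/
abbrev QuiverRep (k : Type u) [Field k] (V : Type v) [Quiver.{w} V] :=
  Paths V ⥤ FGModuleCat.{u} k

instance {C : Type*} [Category* C] (k : Type u) [Field k] :
    HasFiniteBiproducts (C ⥤ FGModuleCat.{u} k) :=
  HasFiniteBiproducts.of_hasFiniteProducts

/-! ### Interval representations -/

namespace LadderRep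

variable (k : Type u) [Field k] {n : ℕ} (I : QuiverInterval (Ladder n))

/-- The vector space of the interval representation `V_I` at the vertex `x`: the functions from the
proofs of `x ∈ I` to `k`, which is a copy of `k` if `x ∈ I`, and zero otherwise. -/
abbrev intervalSpace (x : Ladder n) : Type u := PLift (x ∈ I.carrier) → k

open Classical in
/-- The linear map of `V_I` along an arrow from `x` to `y`: the identity of `k` if both `x` and `y`
are in `I`, and zero otherwise. -/
noncomputable def intervalMap (x y : Ladder n) :
    intervalSpace k I x →ₗ[k] intervalSpace k I y where
  toFun f _ := if hx : x ∈ I.carrier then f ⟨hx⟩ else 0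
  map_add' f g := by
    funext hy
    by_cases hx : x ∈ I.carrier <;> simp [hx]
  map_smul' c f := by
    funext hy
    by_cases hx : x ∈ I.carrier <;> simp [hx]

/-- The interval representation on the path category, before passing to the quotient. -/
noncomputable def intervalPreRep : Paths (Ladder n) ⥤ FGModuleCat.{u} k :=
  Paths.lift
    { obj := fun x => FGModuleCat.of k (intervalSpace k I x)
      map := fun {x y} _ => FGModuleCat.ofHom (intervalMap k I x y) }

open Classical in
theorem intervalPreRep_map_square {x y z : Ladder n} (a : x ⟶ y) (b : y ⟶ z) :
    (intervalPreRep k I).map (X := (x : Paths (Ladder n))) (Y := (z : Paths (Ladder n)))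
      (a.toPath.comp b.toPath) = FGModuleCat.ofHom (intervalMap k I x z) := by
  have h : (intervalPreRep k I).map (X := (x : Paths (Ladder n))) (Y := (z : Paths (Ladder n)))
      (a.toPath.comp b.toPath) = (𝟙 _ ≫ FGModuleCat.ofHom (intervalMap k I x y)) ≫
        FGModuleCat.ofHom (intervalMap k I y z) := rfl
  rw [h, Category.id_comp]
  refine FGModuleCat.hom_ext (LinearMap.ext fun f => funext fun hz => ?_)
  change (if hy : y ∈ I.carrier then (if hx : x ∈ I.carrier then f ⟨hx⟩ else 0) else 0) =
    if hx : x ∈ I.carrier then f ⟨hx⟩ else 0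
  by_cases hx : x ∈ I.carrier
  · have hy : y ∈ I.carrier := I.convex x hx z hz.down y ⟨a.toPath⟩ ⟨b.toPath⟩
    simp [hx, hy]
  · simp [hx]

/-- The interval representation `V_I` of `CL(n)`. -/
noncomputable def interval : LadderRep k n :=
  CategoryTheory.Quotient.lift _ (intervalPreRep k I) (by
    intro x y p p' h
    cases h with
    | square α β =>
      exact (intervalPreRep_map_square k I _ _).trans (intervalPreRep_map_square k I _ _).symm)

end LadderRep

/-! ### Tours -/

namespace LadderCat

theorem pathClass_comp {n : ℕ} {x y z : Ladder n} (p : Quiver.Path x y) (q : Quiver.Path y z) :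
    pathClass (p.comp q) = pathClass p ≫ pathClass q := rfl

/-- A path in the first factor, at a fixed vertex of the second factor. -/
def leftPath {n : ℕ} {a a' : EquiA n} (q : Quiver.Path a a') (b : EquiA 2) :
    Quiver.Path (⟨a, b⟩ : Ladder n) ⟨a', b⟩ :=
  Prefunctor.mapPath
    { obj := fun a => (⟨a, b⟩ : Ladder n), map := fun α => QuiverProd.leftArrow α b } q

/-- A path in the second factor, at a fixed vertex of the first factor. -/
def rightPath {n : ℕ} (a : EquiA n) {b b' : EquiA 2} (r : Quiver.Path b b') :
    Quiver.Path (⟨a, b⟩ : Ladder n) ⟨a, b'⟩ :=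
  Prefunctor.mapPath
    { obj := fun b => (⟨a, b⟩ : Ladder n), map := fun β => QuiverProd.rightArrow a β } r

theorem square {n : ℕ} {a a' : EquiA n} {b b' : EquiA 2} (α : a ⟶ a') (β : b ⟶ b') :
    pathClass ((QuiverProd.rightArrow a β).toPath.comp (QuiverProd.leftArrow α b').toPath) =
    pathClass ((QuiverProd.leftArrow α b).toPath.comp (QuiverProd.rightArrow a' β).toPath) :=
  CategoryTheory.Quotient.sound _ (QuiverProd.TensorRel.square α β)

theorem rightPath_left {n : ℕ} {a a' : EquiA n} (α : a ⟶ a') {b b' : EquiA 2}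
    (r : Quiver.Path b b') :
    pathClass (rightPath a r) ≫ pathClass (QuiverProd.leftArrow α b').toPath =
      pathClass (QuiverProd.leftArrow α b).toPath ≫ pathClass (rightPath a' r) := by
  induction r with
  | nil => exact (Category.id_comp _).trans (Category.comp_id _).symm
  | @cons c c' r β ih =>
    have h1 : pathClass (rightPath a (r.cons β)) =
        pathClass (rightPath a r) ≫ pathClass (QuiverProd.rightArrow a β).toPath := rfl
    have h2 : pathClass (rightPath a' (r.cons β)) =
        pathClass (rightPath a' r) ≫ pathClass (QuiverProd.rightArrow a' β).toPath := rfl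
    have h3 := square α β
    rw [pathClass_comp, pathClass_comp] at h3
    rw [h1, h2, Category.assoc, h3, ← Category.assoc, ih, Category.assoc]

theorem exists_normal_form {n : ℕ} {x y : Ladder n} (p : Quiver.Path x y) :
    ∃ (q : Quiver.Path x.fst y.fst) (r : Quiver.Path x.snd y.snd),
      pathClass p = pathClass ((leftPath q x.snd).comp (rightPath y.fst r)) := by
  induction p with
  | nil => exact ⟨.nil, .nil, rfl⟩
  | cons p e ih =>
    obtain ⟨q, r, h⟩ := ih
    change QuiverProd.Arrow _ _ at e
    cases e with
    | left α b =>
      refine ⟨q.cons α, r, ?_⟩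
      have h1 : pathClass (p.cons (QuiverProd.leftArrow α b)) =
        pathClass p ≫ pathClass (QuiverProd.leftArrow α b).toPath := rfl
      refine h1.trans ?_
      rw [h, pathClass_comp, pathClass_comp, Category.assoc, rightPath_left, ← Category.assoc]
      rfl
    | right a β =>
      refine ⟨q, r.cons β, ?_⟩
      have h1 : pathClass (p.cons (QuiverProd.rightArrow a β)) =
        pathClass p ≫ pathClass (QuiverProd.rightArrow a β).toPath := rfl
      refine h1.trans ?_
      rw [h, pathClass_comp, pathClass_comp, Category.assoc]
      rfl

/-- Full commutativity of `CL(n)`: parallel paths agree modulo the relations. -/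
theorem pathClass_eq {n : ℕ} {x y : Ladder n} (p p' : Quiver.Path x y) :
    pathClass p = pathClass p' := by
  obtain ⟨q, r, h⟩ := exists_normal_form p
  obtain ⟨q', r', h'⟩ := exists_normal_form p'
  rw [h, h', EquiA.path_eq q q', EquiA.path_eq r r']

end LadderCat

namespace Course

variable {n : ℕ} (c : Course.{v, w, 0} (Ladder n))

/-- The functor from the path category of the course which sends an arrow `a ⟶ b` to the class of a
path from `label a` to `label b` (all such paths have the same class). -/
noncomputable def functor : Paths c.V ⥤ LadderCat n :=
  Paths.lift
    { obj := fun a => LadderCat.vertex (c.label a)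
      map := fun a => LadderCat.pathClass (c.exists_path a).some }

/-- The tour on the course `c`, a functor from the representations of `CL(n)` to the representations
of the quiver of the course: it evaluates a representation along `c`. -/
noncomputable def tour (k : Type u) [Field k] : LadderRep k n ⥤ QuiverRep k c.V :=
  (Functor.whiskeringLeft _ _ _).obj c.functor

theorem tour_map_eq {k : Type u} [Field k] (M : LadderRep k n) {a b : c.V} (e : a ⟶ b)
    (p : Quiver.Path (c.label a) (c.label b)) :
    ((c.tour k).obj M).map ((Paths.of c.V).map e) = M.map (LadderCat.pathClass p) := by
  have h : c.functor.map ((Paths.of c.V).map e) = LadderCat.pathClass p :=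
    (Category.id_comp _).trans (LadderCat.pathClass_eq _ _)
  exact congrArg (fun f => M.map f) h

end Course

/-! ### Multiplicities and interval approximations -/

/-- The object `N` is isomorphic to a finite direct sum of indecomposable objects, exactly `d` of
which are isomorphic to `L`. -/
def HasKSMultiplicity {C : Type*} [Category* C] [Preadditive C] [HasBinaryBiproducts C]
    [HasFiniteBiproducts C]
    (N L : C) (d : ℕ) : Prop :=
  ∃ (r : ℕ) (X : Fin r → C), (∀ i, Indecomposable (X i)) ∧ Nonempty (N ≅ ⨁ X) ∧
    Nat.card {i : Fin r // Nonempty (X i ≅ L)} = d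

open Classical in
/-- The multiplicity `d_N(L)` of the indecomposable `L` in `N`. If `N` is a finite-dimensional
representation of a quiver with finitely many vertices, then by the Krull-Schmidt theorem there is
exactly one number `d` as required, so that the default value `0` is not used. -/
noncomputable def ksMultiplicity {C : Type*} [Category* C] [Preadditive C] [HasBinaryBiproducts C]
    [HasFiniteBiproducts C] (N L : C) : ℕ :=
  if h : ∃ d, HasKSMultiplicity N L d then h.choose else 0

section Approximation

variable {k : Type u} [Field k] {n : ℕ}

/-- The `ξ`-compressed multiplicity of `M` on the interval `I`: the multiplicity of the tour of
`V_I` in the tour of `M`, where both tours are on the course `ξ(I)`. -/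
noncomputable def compressedMultiplicity (ξ : EssentialAssignment.{v, w, 0} (Ladder n))
    (M : LadderRep k n) (I : QuiverInterval (Ladder n)) : ℕ :=
  ksMultiplicity (((ξ.course I).tour k).obj M)
    (((ξ.course I).tour k).obj (LadderRep.interval k I))

/-- `δ` is an interval approximation of `M`: for each interval `I`, the `ξ`-compressed multiplicity
of `M` on `I` is the sum of the `δ J` over all intervals `J` that contain `I`. -/
def IsIntervalApproximation (ξ : EssentialAssignment.{v, w, 0} (Ladder n)) (M : LadderRep k n)
    (δ : QuiverInterval (Ladder n) → ℤ) : Prop :=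
  ∀ I, (compressedMultiplicity ξ M I : ℤ) = ∑ᶠ J ∈ Set.Ici I, δ J

/-- Integer-valued functions on a finite partially ordered set are the upper sums of unique
functions. -/
theorem existsUnique_upperSum {P : Type*} [PartialOrder P] [Finite P] (f : P → ℤ) :
    ∃! g : P → ℤ, ∀ x, f x = ∑ᶠ y ∈ Set.Ici x, g y := by
  have key : ∀ (g : P → ℤ) (x : P),
      ∑ᶠ y ∈ Set.Ici x, g y = g x + ∑ᶠ y ∈ Set.Ioi x, g y := by
    intro g x
    rw [← Set.Ioi_insert, finsum_mem_insert g (by simp) (Set.toFinite _)]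
  have wf : WellFounded ((· > ·) : P → P → Prop) := Finite.wellFounded_of_trans_of_irrefl _
  let step : ∀ x : P, (∀ y, y > x → ℤ) → ℤ := fun x F => f x - ∑ᶠ y : Set.Ioi x, F y.1 y.2
  refine ⟨wf.fix step, fun x => ?_, fun g hg => ?_⟩
  · have h : wf.fix step x = f x - ∑ᶠ y : Set.Ioi x, wf.fix step y.1 := wf.fix_eq step x
    rw [key, h, finsum_set_coe_eq_finsum_mem (Set.Ioi x)]
    ring
  · funext x
    induction x using wf.induction with
    | _ x ih =>
      have h : wf.fix step x = f x - ∑ᶠ y : Set.Ioi x, wf.fix step y.1 := wf.fix_eq step x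
      rw [h, finsum_set_coe_eq_finsum_mem (Set.Ioi x), hg x, key,
        finsum_mem_congr (s := Set.Ioi x) rfl (fun y hy => ih y hy)]
      ring

theorem existsUnique_isIntervalApproximation (ξ : EssentialAssignment.{v, w, 0} (Ladder n))
    (M : LadderRep k n) : ∃! δ, IsIntervalApproximation ξ M δ :=
  existsUnique_upperSum (fun I => (compressedMultiplicity ξ M I : ℤ))

/-- The interval approximation `δ^ξ_M` of `M`, a function on the intervals of `CL(n)`. -/
noncomputable def intervalApproximation (ξ : EssentialAssignment.{v, w, 0} (Ladder n))
    (M : LadderRep k n) : QuiverInterval (Ladder n) → ℤ :=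
  (existsUnique_isIntervalApproximation ξ M).choose

theorem isIntervalApproximation_intervalApproximation
    (ξ : EssentialAssignment.{v, w, 0} (Ladder n)) (M : LadderRep k n) :
    IsIntervalApproximation ξ M (intervalApproximation ξ M) :=
  (existsUnique_isIntervalApproximation ξ M).choose_spec.1

end Approximation

/-! Suppose every indecomposable summand of `M` is an interval representation, so that `M` is a
direct sum of `V_{J i}`. The value of the interval approximation at `I` is then the number of `i`
with `J i = I`, which is not negative. To see this, let `L` be the tour of `V_I` on `ξ(I)`. All
labels lie in `I` and the course is connected, so the endomorphisms of `L` are scalars. If `I ≤ J`,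
the tour of `V_J` is isomorphic to `L`. Otherwise convexity of `J` yields an essential vertex of `I`
outside `J`; it is a label, so every composite from `L` through the tour of `V_J` to `L` vanishes
there and, being a scalar, is zero (`splitRank_tour_interval`). Hence the compressed multiplicity at
`I` counts the `i` with `I ≤ J i`, and uniqueness of the inversion gives the claim. The
Krull-Schmidt theorem is avoided: `splitRank` is defined without a decomposition, is additive on
direct sums, and equals the multiplicity of `L` in any decomposition into indecomposables. -/

/-! ### Decompositions into indecomposable objects. -/

section Decomposition

variable {C : Type*} [Category* C] [Preadditive C] [HasBinaryBiproducts C]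

/-- A retract of an object is a direct summand if the retraction has a kernel. -/
theorem exists_iso_biprod_of_retract {X Y : C} (s : X ⟶ Y) (r : Y ⟶ X) (h : s ≫ r = 𝟙 X)
    [HasKernel r] : ∃ Z : C, Nonempty (Y ≅ X ⊞ Z) := by
  have : IsSplitEpi r := IsSplitEpi.mk' ⟨s, h⟩
  exact ⟨kernel r, ⟨biprod.uniqueUpToIso _ _
    (isBilimitBinaryBiconeOfIsSplitEpiOfKernel (kernelIsKernel r)) ≪≫ biprod.braiding _ _⟩⟩

variable [HasFiniteBiproducts C]

/-- A binary direct sum of two finite direct sums is a finite direct sum. -/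
noncomputable def biprodBiproductIso {ι κ : Type} [Finite ι] [Finite κ] (h : ι ⊕ κ → C) :
    (⨁ fun i => h (.inl i)) ⊞ (⨁ fun j => h (.inr j)) ≅ ⨁ h where
  hom := biprod.desc (biproduct.desc fun i => biproduct.ι h (.inl i))
    (biproduct.desc fun j => biproduct.ι h (.inr j))
  inv := biprod.lift (biproduct.lift fun i => biproduct.π h (.inl i))
    (biproduct.lift fun j => biproduct.π h (.inr j))
  hom_inv_id := by
    classical
    ext <;> simp [biproduct.ι_π]
  inv_hom_id := by
    classical
    have := Fintype.ofFinite ι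
    have := Fintype.ofFinite κ
    rw [biprod.lift_desc, biproduct.lift_desc, biproduct.lift_desc, ← biproduct.total,
      Fintype.sum_sum_type]

/-- If a size function is additive on direct sums and vanishes only on zero objects, then every
object is a finite direct sum of indecomposable objects. -/
theorem exists_indecomposable_decomposition (size : C → ℕ)
    (size_zero : ∀ X, size X = 0 → IsZero X)
    (size_iso : ∀ X Y, Nonempty (X ≅ Y) → size X = size Y)
    (size_biprod : ∀ X Y, size (X ⊞ Y) = size X + size Y) (N : C) :
    ∃ (r : ℕ) (X : Fin r → C), (∀ i, Indecomposable (X i)) ∧ Nonempty (N ≅ ⨁ X) := by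
  induction hs : size N using Nat.strong_induction_on generalizing N with
  | _ s ih =>
  by_cases h0 : IsZero N
  · refine ⟨0, Fin.elim0, fun i => i.elim0, ⟨h0.iso ?_⟩⟩
    rw [IsZero.iff_id_eq_zero]
    exact biproduct.hom_ext _ _ fun i => i.elim0
  by_cases hN : Indecomposable N
  · exact ⟨1, fun _ => N, fun _ => hN, ⟨(biproductUniqueIso (fun _ : Fin 1 => N)).symm⟩⟩
  simp only [Indecomposable, not_and, not_forall, not_or] at hN
  obtain ⟨Y, Z, e, hY, hZ⟩ := hN h0
  -- Neither summand is zero, so additivity makes both strictly smaller than `N`.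
  have hYZ : size N = size Y + size Z := (size_iso _ _ ⟨e⟩).trans (size_biprod Y Z)
  have hY' := mt (size_zero Y) hY
  have hZ' := mt (size_zero Z) hZ
  obtain ⟨r, X, hX, ⟨eX⟩⟩ := ih (size Y) (by omega) Y rfl
  obtain ⟨r', X', hX', ⟨eX'⟩⟩ := ih (size Z) (by omega) Z rfl
  refine ⟨r + r', fun i => Sum.elim X X' (finSumFinEquiv.symm i), fun i => ?_,
    ⟨e ≪≫ biprod.mapIso eX eX' ≪≫ biprodBiproductIso (Sum.elim X X') ≪≫
      biproduct.whiskerEquiv finSumFinEquiv (fun s => eqToIso (by simp))⟩⟩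
  change Indecomposable (Sum.elim X X' (finSumFinEquiv.symm i))
  cases finSumFinEquiv.symm i with
  | inl a => exact hX a
  | inr a => exact hX' a

end Decomposition

/-! ### Counting summands by a dimension. -/

section SplitRank

variable (k : Type*) [Field k] {C : Type*} [Category* C] [Preadditive C] [Linear k C]

/-- The morphisms from `L` to `N` that vanish after composition with any morphism to `L`. -/
def nonsplitHom (L N : C) : Submodule k (L ⟶ N) where
  carrier := {f | ∀ g : N ⟶ L, f ≫ g = 0}
  add_mem' {f f'} hf hf' g := by rw [Preadditive.add_comp, hf, hf', add_zero]
  zero_mem' g := zero_comp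
  smul_mem' c f hf g := by rw [Linear.smul_comp, hf, smul_zero]

/-- The dimension of the space of morphisms from `L` to `N` modulo those that vanish after
composition with any morphism to `L`. It counts the summands `L` of `N` if `L` has only scalar
endomorphisms. -/
noncomputable def splitRank (L N : C) : ℕ := Module.finrank k ((L ⟶ N) ⧸ nonsplitHom k L N)

variable {L : C}

theorem splitRank_eq_zero {N : C} (h : ∀ (f : L ⟶ N) (g : N ⟶ L), f ≫ g = 0) :
    splitRank k L N = 0 := by
  have : nonsplitHom k L N = ⊤ := by
    rw [eq_top_iff]
    exact fun f _ => h f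
  rw [splitRank, this]
  exact Module.finrank_zero_of_subsingleton

/-- Testing against the isomorphism itself shows that only the zero morphism is nonsplit, so nothing
is lost in the quotient. -/
theorem splitRank_eq_one (hL : Module.finrank k (L ⟶ L) = 1) {N : C} (e : N ≅ L) :
    splitRank k L N = 1 := by
  have : nonsplitHom k L N = ⊥ := by
    rw [eq_bot_iff]
    intro f hf
    have := hf e.hom
    rw [Submodule.mem_bot]
    simpa using this
  rw [splitRank, this, (Submodule.quotEquivOfEqBot _ rfl).finrank_eq,
    (Linear.homCongr k (Iso.refl L) e).finrank_eq, hL]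

/-- The split rank of an indecomposable object `N` detects whether `N` is isomorphic to `L`. -/
theorem splitRank_indecomposable [HasBinaryBiproducts C] [HasKernels C]
    (hL : Module.finrank k (L ⟶ L) = 1) {N : C} (hN : Indecomposable N)
    [Decidable (Nonempty (N ≅ L))] :
    splitRank k L N = if Nonempty (N ≅ L) then 1 else 0 := by
  split_ifs with h
  · exact splitRank_eq_one k hL h.some
  · refine splitRank_eq_zero k fun f g => ?_
    by_contra hfg
    apply h
    have hid : 𝟙 L ≠ 0 := fun h0 => hfg (by rw [← Category.comp_id (f ≫ g), h0, comp_zero])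
    -- A nonzero composite is an invertible scalar; dividing `g` by it makes `L` a retract of the
    -- indecomposable `N`.
    obtain ⟨c, hc⟩ := (finrank_eq_one_iff_of_nonzero' _ hid).1 hL (f ≫ g)
    have hc0 : c ≠ 0 := by
      rintro rfl
      exact hfg (by rw [← hc, zero_smul])
    obtain ⟨Z, ⟨e⟩⟩ := exists_iso_biprod_of_retract f (c⁻¹ • g)
      (by rw [Linear.comp_smul, ← hc, smul_smul, inv_mul_cancel₀ hc0, one_smul])
    rcases hN.2 L Z e with h1 | h1
    · exact absurd ((IsZero.iff_id_eq_zero L).1 h1) hid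
    · exact ⟨e ≪≫ (isoBiprodZero h1).symm⟩

/-- `splitRank` is additive on direct sums. -/
theorem splitRank_biproduct [HasFiniteBiproducts C] [∀ A B : C, Module.Finite k (A ⟶ B)]
    {N : C} {ι : Type} [Fintype ι] (X : ι → C) (e : N ≅ ⨁ X) :
    splitRank k L N = ∑ i, splitRank k L (X i) := by
  classical
  let E : (L ⟶ N) ≃ₗ[k] (∀ i, L ⟶ X i) :=
    { toFun := fun f i => f ≫ e.hom ≫ biproduct.π X i
      map_add' := fun f g => by funext i; simp
      map_smul' := fun c f => by funext i; simp
      invFun := fun f => biproduct.lift f ≫ e.inv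
      left_inv := fun f => by
        rw [← cancel_mono e.hom]
        refine biproduct.hom_ext _ _ fun i => ?_
        simp
      right_inv := fun f => by funext i; simp }
  -- Nonsplitness is tested componentwise: a morphism out of a summand extends along the projection,
  -- and a morphism out of the sum is the sum of its restrictions.
  have hE : (nonsplitHom k L N).map E.toLinearMap
      = Submodule.pi Set.univ (fun i => nonsplitHom k L (X i)) := by
    ext f
    rw [Submodule.mem_map]
    constructor
    · rintro ⟨f, hf, rfl⟩ i - g
      have := hf (e.hom ≫ biproduct.π X i ≫ g)
      change (f ≫ e.hom ≫ biproduct.π X i) ≫ g = 0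
      simpa using this
    · intro hf
      refine ⟨E.symm f, fun g => ?_, E.apply_symm_apply f⟩
      change (biproduct.lift f ≫ e.inv) ≫ g = 0
      have hg : e.inv ≫ g = biproduct.desc fun i => biproduct.ι X i ≫ e.inv ≫ g :=
        biproduct.hom_ext' _ _ fun i => by simp
      rw [Category.assoc, hg, biproduct.lift_desc]
      exact Finset.sum_eq_zero fun i _ => hf i trivial _
  rw [splitRank, (Submodule.Quotient.equiv _ _ E hE).finrank_eq,
    (Submodule.quotientPi fun i => nonsplitHom k L (X i)).finrank_eq, Module.finrank_pi_fintype]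
  rfl

/-- In any decomposition of `N` into indecomposables, the number of summands `L` is
`splitRank k L N`. -/
theorem HasKSMultiplicity.eq_splitRank [HasBinaryBiproducts C] [HasFiniteBiproducts C]
    [HasKernels C] [∀ A B : C, Module.Finite k (A ⟶ B)]
    (hL : Module.finrank k (L ⟶ L) = 1) {N : C} {d : ℕ} (h : HasKSMultiplicity N L d) :
    d = splitRank k L N := by
  classical
  obtain ⟨r, X, hX, ⟨e⟩, rfl⟩ := h
  rw [splitRank_biproduct k X e,
    Finset.sum_congr rfl fun i _ => splitRank_indecomposable k hL (hX i), Nat.card_eq_fintype_card,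
    Fintype.card_subtype, Finset.card_filter]

end SplitRank

/-! ### Finite-dimensional functors on a category with finitely many objects. -/

section FunctorSize

variable {k : Type u} [Field k] {C : Type*} [Category* C]

theorem FGModuleCat.isZero_of_finrank_eq_zero (V : FGModuleCat.{u} k)
    (h : Module.finrank k V = 0) : IsZero V := by
  have : Subsingleton V := Module.finrank_zero_iff.1 h
  rw [IsZero.iff_id_eq_zero]
  exact FGModuleCat.hom_ext (LinearMap.ext fun x => Subsingleton.elim (α := V) _ _)

theorem FGModuleCat.finrank_biprod (V W : FGModuleCat.{u} k) :
    Module.finrank k (V ⊞ W : FGModuleCat.{u} k) = Module.finrank k V + Module.finrank k W := by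
  have := preservesBinaryBiproduct_of_preservesBiproduct
    (forget₂ (FGModuleCat.{u} k) (ModuleCat.{u} k)) V W
  have e : (forget₂ (FGModuleCat.{u} k) (ModuleCat.{u} k)).obj (V ⊞ W) ≅
      ModuleCat.of k (V × W) :=
    (forget₂ (FGModuleCat.{u} k) (ModuleCat.{u} k)).mapBiprod V W ≪≫
      ModuleCat.biprodIsoProd V.obj W.obj
  exact e.toLinearEquiv.finrank_eq.trans (Module.finrank_prod (R := k) (M := V) (M' := W))

/-- A natural transformation is determined by its finitely many components. Finiteness is what makes
`finrank` additive over products in `splitRank_biproduct`. -/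
instance [Finite C] (F G : C ⥤ FGModuleCat.{u} k) : Module.Finite k (F ⟶ G) := by
  let φ : (F ⟶ G) →ₗ[k] (∀ x, F.obj x ⟶ G.obj x) :=
    LinearMap.pi fun x => NatTrans.appLinearMap x
  refine Module.Finite.of_injective φ fun f g h => ?_
  ext1
  exact h

variable (k C) in
/-- Every finite-dimensional representation of a category with finitely many objects is a finite
direct sum of indecomposable representations. -/
theorem exists_indecomposable_decomposition_functor [Finite C] (N : C ⥤ FGModuleCat.{u} k) :
    ∃ (r : ℕ) (X : Fin r → C ⥤ FGModuleCat.{u} k),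
      (∀ i, Indecomposable (X i)) ∧ Nonempty (N ≅ ⨁ X) := by
  have := Fintype.ofFinite C
  refine exists_indecomposable_decomposition
    (fun F => ∑ x : C, Module.finrank k (F.obj x)) (fun F h => ?_) ?_ (fun F G => ?_) N
  · rw [Finset.sum_eq_zero_iff] at h
    exact Functor.isZero F
      fun x => FGModuleCat.isZero_of_finrank_eq_zero _ (h x (Finset.mem_univ x))
  · rintro F G ⟨e⟩
    exact Finset.sum_congr rfl fun x _ => (FGModuleCat.isoToLinearEquiv (e.app x)).finrank_eq
  · rw [← Finset.sum_add_distrib]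
    refine Finset.sum_congr rfl fun x _ => ?_
    -- Evaluation at `x` is additive, so dimensions add at each object.
    have := preservesBinaryBiproduct_of_preservesBiproduct
      ((evaluation C (FGModuleCat.{u} k)).obj x) F G
    rw [← FGModuleCat.finrank_biprod]
    exact (FGModuleCat.isoToLinearEquiv
      (((evaluation C (FGModuleCat.{u} k)).obj x).mapBiprod F G)).finrank_eq

/-- The multiplicity of a representation that has only scalar endomorphisms. -/
theorem ksMultiplicity_eq_splitRank [Finite C] {L : C ⥤ FGModuleCat.{u} k}
    (hL : Module.finrank k (L ⟶ L) = 1) (N : C ⥤ FGModuleCat.{u} k) :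
    ksMultiplicity N L = splitRank k L N := by
  -- A decomposition exists, so the default value `0` of `ksMultiplicity` is not used.
  have h : ∃ d, HasKSMultiplicity N L d := by
    obtain ⟨r, X, hX, e⟩ := exists_indecomposable_decomposition_functor k C N
    exact ⟨_, r, X, hX, e, rfl⟩
  rw [ksMultiplicity, dif_pos h]
  exact h.choose_spec.eq_splitRank k hL

end FunctorSize

instance {V : Type*} [Quiver V] [Finite V] : Finite (Paths V) := inferInstanceAs (Finite V)

instance (n : ℕ) : Finite (LadderCat n) :=
  Finite.of_injective (fun x : LadderCat n => (x.as : Ladder n)) fun _ _ h =>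
    CategoryTheory.Quotient.ext h

/-! ### Sources and sinks of intervals in the ladder. -/

namespace QuiverInterval

variable {n : ℕ}

/-- The sum of the two coordinates of a vertex of the ladder. -/
def ladderHeight (x : Ladder n) : ℕ := x.fst.idx.val + x.snd.idx.val

/-- The ladder is graded by height, so a walk along arrows, forwards or backwards, must stop. -/
theorem ladderHeight_lt {x y : Ladder n} (e : x ⟶ y) : ladderHeight x < ladderHeight y := by
  change QuiverProd.Arrow _ _ at e
  cases e with
  | left α b => have := α.down; simp only [ladderHeight]; omega
  | right a β => have := β.down; simp only [ladderHeight]; omega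

/-- Arrows inside `I` are followed until none leaves the current vertex. -/
theorem exists_path_to_sink (I : QuiverInterval (Ladder n)) {x : Ladder n} (hx : x ∈ I.carrier) :
    ∃ t ∈ I.essentialVertices, Nonempty (Quiver.Path x t) := by
  induction hm : 2 + n - ladderHeight x using Nat.strong_induction_on generalizing x with
  | _ m ih =>
  by_cases h : ∀ w ∈ I.carrier, IsEmpty (x ⟶ w)
  · exact ⟨x, ⟨hx, Or.inr h⟩, ⟨.nil⟩⟩
  · push Not at h
    obtain ⟨y, hy, ⟨e⟩⟩ := h
    have h1 := ladderHeight_lt e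
    -- The height bound ensures that the truncated difference really decreases.
    have h2 : ladderHeight y < 2 + n := by
      have := y.fst.idx.isLt
      have := y.snd.idx.isLt
      simp only [ladderHeight]
      omega
    obtain ⟨t, ht, ⟨p⟩⟩ := ih _ (by omega) hy rfl
    exact ⟨t, ht, ⟨e.toPath.comp p⟩⟩

theorem exists_path_from_source (I : QuiverInterval (Ladder n)) {x : Ladder n}
    (hx : x ∈ I.carrier) : ∃ s ∈ I.essentialVertices, Nonempty (Quiver.Path s x) := by
  induction hm : ladderHeight x using Nat.strong_induction_on generalizing x with
  | _ m ih =>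
  by_cases h : ∀ w ∈ I.carrier, IsEmpty (w ⟶ x)
  · exact ⟨x, ⟨hx, Or.inl h⟩, ⟨.nil⟩⟩
  · push Not at h
    obtain ⟨y, hy, ⟨e⟩⟩ := h
    have h1 := ladderHeight_lt e
    obtain ⟨t, ht, ⟨p⟩⟩ := ih _ (by omega) hy rfl
    exact ⟨t, ht, ⟨p.comp e.toPath⟩⟩

/-- An interval is contained in every interval that contains its essential vertices. -/
theorem le_of_essentialVertices_subset {I J : QuiverInterval (Ladder n)}
    (h : I.essentialVertices ⊆ J.carrier) : I ≤ J := by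
  intro x hx
  obtain ⟨s, hs, p⟩ := I.exists_path_from_source hx
  obtain ⟨t, ht, q⟩ := I.exists_path_to_sink hx
  exact J.convex s (h hs) t (h ht) x p q

end QuiverInterval

/-! ### Interval representations along paths. -/

namespace LadderRep

variable (k : Type u) [Field k] {n : ℕ} (I : QuiverInterval (Ladder n))

/-- The interval representation is the identity along every path inside the interval. -/
theorem intervalPreRep_map_apply {x y : Ladder n} (p : Quiver.Path x y) (hx : x ∈ I.carrier)
    (f : intervalSpace k I x) (hy : PLift (y ∈ I.carrier)) :
    (show intervalSpace k I y from ((intervalPreRep k I).map (X := (x : Paths (Ladder n)))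
      (Y := (y : Paths (Ladder n))) p).hom.hom f) hy = f ⟨hx⟩ := by
  induction p with
  | nil => rfl
  | @cons z y p e ih =>
    -- By convexity the path never leaves `I`, so no zero map occurs on it.
    have hz : z ∈ I.carrier := I.convex x hx y hy.down z ⟨p⟩ ⟨e.toPath⟩
    exact (dif_pos hz).trans (ih ⟨hz⟩)

/-- The interval representation is the identity along every morphism inside the interval. -/
theorem interval_map_apply {x y : LadderCat n} (m : x ⟶ y) (hx : x.as ∈ I.carrier)
    (f : intervalSpace k I x.as) (hy : PLift (y.as ∈ I.carrier)) :
    (show intervalSpace k I y.as from ((interval k I).map m).hom.hom f) hy = f ⟨hx⟩ := by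
  obtain ⟨x⟩ := x
  obtain ⟨y⟩ := y
  obtain ⟨p, rfl⟩ := (CategoryTheory.Quotient.functor _).map_surjective m
  exact intervalPreRep_map_apply k I p hx f hy

end LadderRep

/-! ### Tours of interval representations. -/

namespace Course

variable {n : ℕ} (c : Course.{v, w, 0} (Ladder n)) (k : Type u) [Field k]
  {I J : QuiverInterval (Ladder n)}

/-- Additivity lets tours commute with finite direct sums. -/
instance : (c.tour k).Additive where

/-- If all labels of the course lie in both intervals, then the two tours are isomorphic. -/
noncomputable def tourIntervalIso (hI : ∀ a, c.label a ∈ I.carrier)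
    (hJ : ∀ a, c.label a ∈ J.carrier) :
    (c.tour k).obj (LadderRep.interval k J) ≅ (c.tour k).obj (LadderRep.interval k I) :=
  NatIso.ofComponents (fun a => LinearEquiv.toFGModuleCatIso (LinearEquiv.funCongrLeft k k
      (Equiv.plift.trans ((Equiv.ofIff (iff_of_true (hI a) (hJ a))).trans Equiv.plift.symm)))) (by
    intro a b f
    refine FGModuleCat.hom_ext (LinearMap.ext fun t => funext fun hb => ?_)
    exact (LadderRep.interval_map_apply k J (c.functor.map f) (hJ a) t ⟨hJ b⟩).trans
      (LadderRep.interval_map_apply k I (c.functor.map f) (hI a)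
        (LinearEquiv.funCongrLeft k k (Equiv.plift.trans
          ((Equiv.ofIff (iff_of_true (hI a) (hJ a))).trans Equiv.plift.symm)) t) hb).symm)

/-- The endomorphisms of the tour of an interval representation that contains all labels are the
scalars. -/
theorem finrank_end_tour_interval (hI : ∀ a, c.label a ∈ I.carrier) :
    Module.finrank k ((c.tour k).obj (LadderRep.interval k I) ⟶
      (c.tour k).obj (LadderRep.interval k I)) = 1 := by
  let L := (c.tour k).obj (LadderRep.interval k I)
  let φ : (L ⟶ L) → ∀ a : c.V, LadderRep.intervalSpace k I (c.label a) →ₗ[k]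
    LadderRep.intervalSpace k I (c.label a) := fun f a => (f.app a).hom.hom
  -- The space at each label is a line, so `f` acts at `a` by the scalar `s f a`.
  let s : (L ⟶ L) → c.V → k := fun f a => φ f a (fun _ => 1) ⟨hI a⟩
  have hs : ∀ f (a : c.V) (t : LadderRep.intervalSpace k I (c.label a)) h,
      φ f a t h = s f a * t ⟨hI a⟩ := by
    intro f a t h
    have ht : t = t ⟨hI a⟩ • (fun _ => 1 : LadderRep.intervalSpace k I (c.label a)) := by
      funext _
      simp
    conv_lhs => rw [ht, map_smul]
    exact mul_comm _ _
  -- `V_I` is the identity along the arrow, so naturality equates the scalars at its ends.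
  have harrow : ∀ f {a b : c.V} (_ : a ⟶ b), s f a = s f b := by
    intro f a b e
    have h1 := congrArg (fun m : L.obj a ⟶ L.obj b =>
      (show LadderRep.intervalSpace k I (c.label b) from
        m.hom.hom (fun _ => 1 : LadderRep.intervalSpace k I (c.label a))) ⟨hI b⟩)
      (f.naturality ((Paths.of c.V).map e))
    have h2 : (show LadderRep.intervalSpace k I (c.label b) from
        (L.map ((Paths.of c.V).map e)).hom.hom
          (fun _ => 1 : LadderRep.intervalSpace k I (c.label a))) = fun _ => 1 :=
      funext fun h => LadderRep.interval_map_apply k I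
        (c.functor.map ((Paths.of c.V).map e)) (hI a) (fun _ => 1) h
    have h3 := LadderRep.interval_map_apply k I
        (c.functor.map ((Paths.of c.V).map e)) (hI a) (φ f a (fun _ => 1)) ⟨hI b⟩
    exact (h3.symm.trans h1.symm).trans (congrArg (fun t => φ f b t ⟨hI b⟩) h2)
  have hconst : ∀ f (a b : c.V), s f a = s f b := by
    intro f a b
    have key : ∀ u v : (Set.univ : Set c.V),
        Relation.EqvGen (fun a b : (Set.univ : Set c.V) => Nonempty (a.1 ⟶ b.1)) u v →
          s f u.1 = s f v.1 := by
      intro u v h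
      induction h with
      | rel x y h => exact harrow f h.some
      | refl x => rfl
      | symm x y _ ih => exact ih.symm
      | trans x y z _ _ ih₁ ih₂ => exact ih₁.trans ih₂
    exact key _ _ (c.connected.2 ⟨a, trivial⟩ ⟨b, trivial⟩)
  obtain ⟨a₀, -⟩ := c.connected.1
  have hne : 𝟙 L ≠ 0 := fun h0 => by
    have h1 : s (𝟙 L) a₀ = 1 := rfl
    rw [h0] at h1
    exact zero_ne_one h1
  refine (finrank_eq_one_iff_of_nonzero' _ hne).2 fun f => ⟨s f a₀, ?_⟩
  refine NatTrans.ext (funext fun a => FGModuleCat.hom_ext (LinearMap.ext fun t =>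
    funext fun h => ?_))
  refine Eq.trans ?_ (hs f a t h).symm
  rw [hconst f a a₀]
  rfl

/-- The tour of `V_I` on an essential course of `I` is a summand of the tour of `V_J` exactly if
`J` contains `I`. -/
theorem splitRank_tour_interval (hI : ∀ a, c.label a ∈ I.carrier)
    (hess : I.essentialVertices ⊆ Set.range c.label) [Decidable (I ≤ J)] :
    splitRank k ((c.tour k).obj (LadderRep.interval k I))
      ((c.tour k).obj (LadderRep.interval k J)) = if I ≤ J then 1 else 0 := by
  split_ifs with h
  · exact splitRank_eq_one k (c.finrank_end_tour_interval k hI)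
      (c.tourIntervalIso k hI fun a => h (hI a))
  · obtain ⟨x, hx, hxJ⟩ := Set.not_subset.1 (mt QuiverInterval.le_of_essentialVertices_subset h)
    obtain ⟨a, rfl⟩ := hess hx
    refine splitRank_eq_zero k fun f g => ?_
    by_contra hfg
    -- A nonzero composite would span the endomorphisms, so the identity would be a multiple of it;
    -- this fails at `a`.
    obtain ⟨d, hd⟩ := (finrank_eq_one_iff_of_nonzero' _ hfg).1
      (c.finrank_end_tour_interval k hI) (𝟙 _)
    -- The label of `a` is outside `J`, so the target consists of functions on an empty type.
    have hf : f.app a = 0 := FGModuleCat.hom_ext (LinearMap.ext fun t =>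
      funext fun h => absurd h.down hxJ)
    have h1 := congrArg (fun m => NatTrans.app (C := Paths c.V) m a) hd
    have h2 : d • (f.app a ≫ g.app a) = 𝟙 _ := h1
    rw [hf, zero_comp, smul_zero] at h2
    exact zero_ne_one (congrArg (fun m : ((c.tour k).obj (LadderRep.interval k I)).obj a ⟶
      ((c.tour k).obj (LadderRep.interval k I)).obj a =>
      (show LadderRep.intervalSpace k I (c.label a) from
        m.hom.hom (fun _ => 1 : LadderRep.intervalSpace k I (c.label a))) ⟨hI a⟩) h2)

end Course

/-! ### Direct sums of interval representations and the conclusion. -/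

section IntervalDecomposable

variable {k : Type u} [Field k] {n : ℕ}

open Classical in
/-- The compressed multiplicity of a direct sum of interval representations counts the summands
whose interval contains the given one. -/
theorem compressedMultiplicity_of_iso_biproduct (ξ : EssentialAssignment.{v, w, 0} (Ladder n))
    {M : LadderRep k n} {r : ℕ} (X : Fin r → LadderRep k n) (e : M ≅ ⨁ X)
    (J : Fin r → QuiverInterval (Ladder n)) (hJ : ∀ i, Nonempty (X i ≅ LadderRep.interval k (J i)))
    (I : QuiverInterval (Ladder n)) :
    compressedMultiplicity ξ M I = ∑ i, if I ≤ J i then 1 else 0 := by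
  have hI : ∀ a, (ξ.course I).label a ∈ I.carrier := fun a => (ξ.essential I).2 ⟨a, rfl⟩
  let Y : Fin r → LadderRep k n := fun i => LadderRep.interval k (J i)
  let T := (ξ.course I).tour k
  have e' : T.obj M ≅ ⨁ T.obj ∘ Y :=
    T.mapIso (e ≪≫ biproduct.mapIso fun i => (hJ i).some) ≪≫ T.mapBiproduct Y
  -- The tours of the summands may decompose further; `splitRank` is additive over arbitrary direct
  -- sums, so this does not matter.
  rw [compressedMultiplicity,
    ksMultiplicity_eq_splitRank ((ξ.course I).finrank_end_tour_interval k hI),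
    splitRank_biproduct k (T.obj ∘ Y) e']
  exact Finset.sum_congr rfl fun i _ =>
    (ξ.course I).splitRank_tour_interval k hI (ξ.essential I).1

open Classical in
/-- The interval approximation of a direct sum of interval representations is the function of
multiplicities. -/
theorem intervalApproximation_of_iso_biproduct (ξ : EssentialAssignment.{v, w, 0} (Ladder n))
    {M : LadderRep k n} {r : ℕ} (X : Fin r → LadderRep k n) (e : M ≅ ⨁ X)
    (J : Fin r → QuiverInterval (Ladder n)) (hJ : ∀ i, Nonempty (X i ≅ LadderRep.interval k (J i)))
    (I : QuiverInterval (Ladder n)) :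
    intervalApproximation ξ M I = ∑ i, if J i = I then 1 else 0 := by
  refine congrFun ((existsUnique_isIntervalApproximation ξ M).unique
    (isIntervalApproximation_intervalApproximation ξ M)
    (y₂ := fun I => ∑ i, if J i = I then 1 else 0) fun I => ?_) I
  have := Fintype.ofFinite (QuiverInterval (Ladder n))
  rw [compressedMultiplicity_of_iso_biproduct ξ X e J hJ,
    finsum_mem_eq_finite_toFinset_sum _ (Set.toFinite _), Finset.sum_comm]
  push_cast
  refine Finset.sum_congr rfl fun i _ => ?_
  -- For fixed `i` only the interval `J i` contributes, and it is in the range of summation exactly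
  -- if `I ≤ J i`.
  rw [Finset.sum_ite_eq]
  simp

end IntervalDecomposable

theorem mainTheorem6 {k : Type u} [Field k] {n : ℕ} (M : LadderRep k n)
    (h : ∃ (ξ : EssentialAssignment.{v, w, 0} (Ladder n)) (I : QuiverInterval (Ladder n)),
      intervalApproximation ξ M I < 0) :
    ∃ N N' : LadderRep k n, Nonempty (M ≅ N ⊞ N') ∧ Indecomposable N ∧
      ∀ J : QuiverInterval (Ladder n), ¬ Nonempty (N ≅ LadderRep.interval k J) := by
  obtain ⟨ξ, I, hδ⟩ := h
  obtain ⟨r, X, hX, ⟨e⟩⟩ := exists_indecomposable_decomposition_functor k (LadderCat n) M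
  by_contra hM
  have hJ : ∀ i, ∃ J, Nonempty (X i ≅ LadderRep.interval k J) := by
    intro i
    by_contra hi
    push Not at hi
    -- The kernel of the projection to `X i` serves as the complementary summand.
    obtain ⟨Z, hZ⟩ := exists_iso_biprod_of_retract (biproduct.ι X i ≫ e.inv)
      (e.hom ≫ biproduct.π X i) (by simp)
    exact hM ⟨X i, Z, hZ, hX i, fun J => not_nonempty_iff.2 (hi J)⟩
  choose J hJ using hJ
  classical
  rw [intervalApproximation_of_iso_biproduct ξ X e J hJ I] at hδ
  exact hδ.not_ge (Finset.sum_nonneg fun i _ => by split_ifs <;> simp)
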